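/- **Setting.** Let $G=(V,E)$ be a directed graph with finitely many edges (parallel edges allowed), let $s\neq t$ be two vertices and let $k\ge 1$. The *$k$-paths system* on $G$ has the edges as agents; a set $S\subseteq E$ is *feasible* ($S\in\mathcal F$) if it contains $k$ pairwise edge-disjoint (simple, directed) $s$-$t$ paths. Assume that the system is *monopoly-free*: no edge belongs to all feasible sets. Costs and bids are nonnegative reals, and for $\mathbf b\in\mathbb R_{\ge 0}^E$ write $b(S)=\sum_{e\in S}b(e)$. *Dependency graphs.* Let $\mathcal G^{k+1}$ be the collection of all edge sets that are a union of $k+1$ edge-disjoint $s$-$t$ paths. For $A\in\mathcal G^{k+1}$, the dependency graph $\mathcal H(A)$ has vertex set $A$, and distinct $e,e'\in A$ are adjacent iff every feasible set contained in $A$ contains $e$ or $e'$. Let $\alpha(A)$ be the maximum, over the connected components of $\mathcal H(A)$, of the largest eigenvalue of the adjacency matrix of the component, and let $\alpha_{k+1}=\max\{\alpha(A) : A\in\mathcal G^{k+1}\}$. *The Pruning-Lifting $k$-Paths Mechanism.* On a bid vector $\mathbf b$: 1. (Pruning) Pick $A=A(\mathbf b)\in\mathcal G^{k+1}$ minimizing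 $b(A)$. 2. (Lifting) On each connected component of $\mathcal H(A)$ take a positive eigenvector of its adjacency matrix for its largest eigenvalue; together these give weights $w(e)>0$, $e\in A$, which depend only on $A$. 3. (Winner selection) Among the feasible sets contained in $A$, select as the set of winners a set $S$ minimizing $\sum_{e\in S}b(e)/w(e)$. 4. (Payment) Each winner $e$ is paid $\min\{t_1(e),t_2(e)\}$, where, with the bids of the other agents fixed, $t_1(e)$ is the infimum of the bids of $e$ at which $e$ is dropped in the pruning stage ($+\infty$ if there are none) and $t_2(e)$ is the supremum of the bids of $e$ at which $e$ is selected in step 3 from the fixed set $A$; all other agents are paid $0$. Ties in steps 1 and 3 and the scaling of the eigenvectors in step 2 are resolved by arbitrary fixed rules. Let $p(\mathbf c)$ be the total payment on the bid vector $\mathbf c$. *The benchmark $\mu$.* For a cost vector $\mathbf c$ and a feasible set $S$ minimizing $c(S)$, let $\mu(\mathbf c)$ be the maximum of $\sum_{e\in S}b(e)$ over all bid vectors $\mathbf b$ such that 1. $b(e)\ge c(e)$ for all $e\in E$; 2. $\sum_{e\in S\setminus T}b(e)\le\sum_{e\in T\setminus S}c(e)$ for all $T\in\mathcal F$; 3.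 for every $e\in S$ there is $T\in\mathcal F$ with $e\notin T$ and $\sum_{e'\in S\setminus T}b(e')=\sum_{e'\in T\setminus S}c(e')$. The *$\mu$-frugality ratio* of the mechanism is $\sup_{\mathbf c}\,p(\mathbf c)/\mu(\mathbf c)$, over all cost vectors $\mathbf c\in\mathbb R_{\ge 0}^E$, with $0/0=0$ and $x/0=+\infty$ for $x>0$. **Theorem.** For every such $G,s,t,k$, and for every choice of the tie-breaking rules, of the scaling of the eigenvectors and of the cheapest sets $S$ in the definition of $\mu$, the $\mu$-frugality ratio of the Pruning-Lifting $k$-Paths Mechanism satisfies $$\sup_{\mathbf c}\frac{p(\mathbf c)}{\mu(\mathbf c)}\;\le\;\frac{\alpha_{k+1}}{k}.$$ -/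

import Mathlib

open scoped NNReal ENNReal

noncomputable section

/-! ### Set systems

A set system on a finite set `E` of agents is given by its collection `F : Set (Finset E)` of
feasible sets. Costs and bids are vectors of nonnegative reals `E → ℝ≥0`. -/

section SetSystem

variable {E : Type*} [DecidableEq E]

/-- No agent belongs to all feasible sets. -/
def MonopolyFree (F : Set (Finset E)) : Prop :=
  ∀ e : E, ∃ S ∈ F, e ∉ S

/-- `S` is a feasible set of minimum total cost with respect to `c`. -/
def IsCheapest (F : Set (Finset E)) (c : E → ℝ≥0) (S : Finset E) : Prop :=
  S ∈ F ∧ ∀ T ∈ F, ∑ e ∈ S, c e ≤ ∑ e ∈ T, c e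

/-- Constraints (1), (2), (3) of the optimization problem that defines the benchmark, for the cost
vector `c` and a cheapest feasible set `S`. -/
structure BenchmarkConstraints (F : Set (Finset E)) (c : E → ℝ≥0) (S : Finset E)
    (b : E → ℝ≥0) : Prop where
  cost_le : ∀ e, c e ≤ b e
  no_undercut : ∀ T ∈ F, ∑ e ∈ S \ T, b e ≤ ∑ e ∈ T \ S, c e
  tight : ∀ e ∈ S, ∃ T ∈ F, e ∉ T ∧ ∑ e' ∈ S \ T, b e' = ∑ e' ∈ T \ S, c e'

/-- The benchmark `μ(c)`: the largest total bid `∑ e ∈ S, b e` over all bid vectors `b` that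
satisfy the constraints (1), (2), (3). -/
def benchmarkMu (F : Set (Finset E)) (c : E → ℝ≥0) (S : Finset E) : ℝ≥0∞ :=
  ⨆ (b : E → ℝ≥0) (_ : BenchmarkConstraints F c S b), ((∑ e ∈ S, b e : ℝ≥0) : ℝ≥0∞)

/-- The `μ`-frugality ratio `sup_c p(c) / μ(c)` of a mechanism with total payment `p`, where
`σ c` is the cheapest feasible set used in the definition of `μ(c)`.
In `ℝ≥0∞` one has `0 / 0 = 0` and `x / 0 = ∞` for `x ≠ 0`. -/
def muFrugalityRatio (F : Set (Finset E)) (σ : (E → ℝ≥0) → Finset E)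
    (p : (E → ℝ≥0) → ℝ≥0∞) : ℝ≥0∞ :=
  ⨆ c : E → ℝ≥0, p c / benchmarkMu F c (σ c)

/-- The dependency graph of a set `A` of surviving agents: distinct agents `e, e'` of `A` are
adjacent iff every feasible set contained in `A` contains `e` or `e'`. -/
def dependencyGraph (F : Set (Finset E)) (A : Finset E) : SimpleGraph A where
  Adj e e' := e ≠ e' ∧ ∀ T ∈ F, T ⊆ A → (e : E) ∈ T ∨ (e' : E) ∈ T
  symm := ⟨fun _ _ h => ⟨h.1.symm, fun T hT hTA => (h.2 T hT hTA).symm⟩⟩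
  loopless := ⟨fun _ h => h.1 rfl⟩

open Classical in
/-- The adjacency matrix of a connected component of the dependency graph of `A`. -/
def componentMatrix (F : Set (Finset E)) (A : Finset E)
    (C : (dependencyGraph F A).ConnectedComponent) : Matrix C C ℝ :=
  C.toSimpleGraph.adjMatrix ℝ

open Classical in
/-- The largest eigenvalue of the adjacency matrix of a connected component. -/
def componentEigenvalue (F : Set (Finset E)) (A : Finset E)
    (C : (dependencyGraph F A).ConnectedComponent) : ℝ :=
  sSup (spectrum ℝ (componentMatrix F A C))

/-- The maximum, over the connected components of the dependency graph of `A`, of the largest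
eigenvalue of the adjacency matrix of the component. -/
def dependencyEigenvalue (F : Set (Finset E)) (A : Finset E) : ℝ :=
  ⨆ C : (dependencyGraph F A).ConnectedComponent, componentEigenvalue F A C

open Classical in
/-- `w` is a vector of weights on `A` as computed in the lifting stage: it is positive, and its
restriction to each connected component of the dependency graph is an eigenvector of the adjacency
matrix of the component for the largest eigenvalue. -/
structure IsLiftingWeight (F : Set (Finset E)) (A : Finset E) (w : E → ℝ) : Prop where
  pos : ∀ e ∈ A, 0 < w e
  eigen : ∀ C : (dependencyGraph F A).ConnectedComponent,
    (componentMatrix F A C).mulVec (fun e : C => w (e : A)) =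
      componentEigenvalue F A C • (fun e : C => w (e : A))

end SetSystem

/-! ### Directed graphs and `k`-paths systems -/

/-- A directed graph with vertex set `V` and edge set `E`. -/
structure DirectedGraph (V E : Type*) where
  src : E → V
  tgt : E → V

section Paths

variable {V E : Type*}

/-- `G.IsWalk u p v`: the list of edges `p` is a directed walk from `u` to `v`. -/
def DirectedGraph.IsWalk (G : DirectedGraph V E) : V → List E → V → Prop
  | u, [], v => u = v
  | u, e :: p, v => G.src e = u ∧ G.IsWalk (G.tgt e) p v

/-- A directed path is a directed walk that does not repeat a vertex. -/
def DirectedGraph.IsPath (G : DirectedGraph V E) (u : V) (p : List E) (v : V) : Prop :=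
  G.IsWalk u p v ∧ (u :: p.map G.tgt).Nodup

/-- `P 0, …, P (n - 1)` are `n` pairwise edge-disjoint paths from `s` to `t`. -/
def DirectedGraph.EdgeDisjointPaths (G : DirectedGraph V E) (s t : V) {n : ℕ}
    (P : Fin n → List E) : Prop :=
  (∀ i, G.IsPath s (P i) t) ∧ ∀ i j, i ≠ j → (P i).Disjoint (P j)

variable [DecidableEq E]

/-- The set of all edges of a family of paths. -/
def pathsUnion {n : ℕ} (P : Fin n → List E) : Finset E :=
  Finset.univ.biUnion fun i => (P i).toFinset

/-- The `k`-paths system: a set of edges is feasible iff it contains `k` edge-disjoint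
`s`-`t` paths. -/
def DirectedGraph.kPathsSystem (G : DirectedGraph V E) (s t : V) (k : ℕ) : Set (Finset E) :=
  {S | ∃ P : Fin k → List E, G.EdgeDisjointPaths s t P ∧ pathsUnion P ⊆ S}

/-- The edge sets of the subgraphs that are a union of `n` edge-disjoint `s`-`t` paths. -/
def DirectedGraph.pathUnions (G : DirectedGraph V E) (s t : V) (n : ℕ) : Set (Finset E) :=
  {A | ∃ P : Fin n → List E, G.EdgeDisjointPaths s t P ∧ pathsUnion P = A}

/-- `α_{k+1}`: the maximum of the eigenvalue of the dependency graph (with respect to the `k`-paths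
system) over all unions of `k + 1` edge-disjoint `s`-`t` paths. -/
def DirectedGraph.alphaSucc (G : DirectedGraph V E) (s t : V) (k : ℕ) : ℝ :=
  sSup (dependencyEigenvalue (G.kPathsSystem s t k) '' G.pathUnions s t (k + 1))

/-- The Pruning-Lifting `k`-Paths Mechanism. The fields record how the choices that the description
of the mechanism leaves open are made: ties in the pruning stage and in the winner selection, and
the scaling of the eigenvectors. -/
structure PruningLiftingKPaths (G : DirectedGraph V E) (s t : V) (k : ℕ) where
  /-- Pruning: the edges of the `k + 1` edge-disjoint paths picked on a bid vector. -/
  prune : (E → ℝ≥0) → Finset E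
  prune_cheapest : ∀ b, IsCheapest (G.pathUnions s t (k + 1)) b (prune b)
  /-- Lifting: the weights attached to a surviving set. -/
  weight : Finset E → E → ℝ
  weight_lifting : ∀ A ∈ G.pathUnions s t (k + 1),
    IsLiftingWeight (G.kPathsSystem s t k) A (weight A)
  /-- Winner selection: the feasible subset of the surviving set `A` chosen on a bid vector. -/
  select : Finset E → (E → ℝ≥0) → Finset E
  select_feasible : ∀ A ∈ G.pathUnions s t (k + 1), ∀ b,
    select A b ∈ G.kPathsSystem s t k ∧ select A b ⊆ A
  select_cheapest : ∀ A ∈ G.pathUnions s t (k + 1), ∀ b, ∀ T ∈ G.kPathsSystem s t k, T ⊆ A →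
    ∑ e ∈ select A b, (b e : ℝ) / weight A e ≤ ∑ e ∈ T, (b e : ℝ) / weight A e

namespace PruningLiftingKPaths

variable {G : DirectedGraph V E} {s t : V} {k : ℕ} (M : PruningLiftingKPaths G s t k)

/-- The set of winners on the bid vector `b`. -/
def winners (b : E → ℝ≥0) : Finset E :=
  M.select (M.prune b) b

/-- `t₁(e)`: the infimum of the bids at which `e` is dropped in the pruning stage, given the
others' bids (`∞` if there are none). -/
def pruneThreshold (b : E → ℝ≥0) (e : E) : ℝ≥0∞ :=
  ⨅ (x : ℝ≥0) (_ : e ∉ M.prune (Function.update b e x)), (x : ℝ≥0∞)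

/-- `t₂(e)`: the threshold bid of `e` in the winner selection stage, i.e. the supremum of the bids
at which `e` is selected, given the others' bids and the surviving set. -/
def selectThreshold (b : E → ℝ≥0) (e : E) : ℝ≥0∞ :=
  ⨆ (x : ℝ≥0) (_ : e ∈ M.select (M.prune b) (Function.update b e x)), (x : ℝ≥0∞)

/-- The payment to agent `e`. -/
def payment (b : E → ℝ≥0) (e : E) : ℝ≥0∞ :=
  if e ∈ M.winners b then min (M.pruneThreshold b e) (M.selectThreshold b e) else 0

/-- The total payment. -/
def totalPayment [Fintype E] (b : E → ℝ≥0) : ℝ≥0∞ :=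
  ∑ e, M.payment b e

end PruningLiftingKPaths

end Paths

end

/-!
Let `A` be the pruned edge set on the cost vector `c`, let `W ⊆ A` be the winners, let `S` be a
cheapest feasible set and put `δ = c(A) - c(S)`. The theorem follows from `p(c) ≤ α(A) * δ` and
`k * δ ≤ μ(c)`.

*Lower bound on `μ`.* Let `S'` be the union of `k` edge-disjoint paths in `S`. A closed trail of the
residual graph of `S'` augments it to another `k`-flow, and a residual trail from `s` to `t` to a
`(k + 1)`-flow. As these cost at least `c(S)` and `c(A)`, there are vertex potentials `π` with
`π t - π s ≥ δ` such that the edges `u → v` of `S'` cost at most `π v - π u` and all others at least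
that much (`DirectedGraph.exists_potential_of_isCheapest`). If the edges of `S'` bid their potential
differences, no feasible set undercuts `S`, and the total bid is `k * (π t - π s)`. A bid vector of
largest total among those without undercutting also satisfies the tightness condition
(`le_benchmarkMu`).

*Upper bound on the payments.* Edges of `A` on a closed trail in `A` are free and dispensable in the
pruning stage, so `t₁ = 0` for them. A set of other edges of `A` that is independent in the
dependency graph lies on a single trail starting in `s`, so that its complement in `A` is feasible
(`DirectedGraph.sdiff_mem_kPathsSystem`). Hence a winner can be replaced by its losing neighbours,
up to free edges, which gives `t₂(e) ≤ w(e) * ∑ c(f) / w(f)`, the sum being over the losing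
neighbours `f` of `e` (`PruningLiftingKPaths.selectThreshold_le`). Summing over the winners and
using that `w` is an eigenvector, the payments add up to at most `α(A) * c(A \ W)`, and
`c(A \ W) = c(A) - c(W) ≤ δ` as `W` is feasible.
-/

open scoped NNReal ENNReal

/-! ### Walks and balanced edge sets -/

namespace DirectedGraph

variable {V E : Type*}

/-- The boundary of an edge, as the formal difference `src e - tgt e`. -/
noncomputable def boundary (G : DirectedGraph V E) (e : E) : V →₀ ℤ :=
  Finsupp.single (G.src e) 1 - Finsupp.single (G.tgt e) 1

/-- The excess of a set of edges: at each vertex, the number of outgoing edges minus the number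
of incoming edges. -/
noncomputable def excess (G : DirectedGraph V E) (A : Finset E) : V →₀ ℤ :=
  ∑ e ∈ A, G.boundary e

variable (G : DirectedGraph V E)

theorem isWalk_append {u v : V} {p q : List E} :
    G.IsWalk u (p ++ q) v ↔ ∃ m, G.IsWalk u p m ∧ G.IsWalk m q v := by
  induction p generalizing u with
  | nil => simp [IsWalk]
  | cons e p ih => simp [IsWalk, ih, and_assoc]

theorem IsWalk.sum_boundary {G : DirectedGraph V E} {u v : V} {p : List E}
    (h : G.IsWalk u p v) :
    (p.map G.boundary).sum = Finsupp.single u 1 - Finsupp.single v 1 := by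
  induction p generalizing u with
  | nil => obtain rfl : u = v := h; simp
  | cons e p ih =>
    obtain ⟨rfl, h⟩ := h
    simp [ih h, boundary]

theorem IsWalk.excess_toFinset [DecidableEq E] {G : DirectedGraph V E} {u v : V} {p : List E}
    (h : G.IsWalk u p v) (hp : p.Nodup) :
    G.excess p.toFinset = Finsupp.single u 1 - Finsupp.single v 1 := by
  rw [excess, List.sum_toFinset _ hp, h.sum_boundary]

theorem excess_sdiff [DecidableEq E] {A B : Finset E} (h : B ⊆ A) :
    G.excess (A \ B) = G.excess A - G.excess B := by
  rw [eq_sub_iff_add_eq]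
  exact Finset.sum_sdiff h

theorem IsPath.nodup {G : DirectedGraph V E} {u v : V} {p : List E} (h : G.IsPath u p v) :
    p.Nodup :=
  List.Nodup.of_map _ (List.nodup_cons.1 h.2).2

/-- A vertex visited by a walk starts a final segment of that walk. -/
theorem IsPath.exists_suffix {G : DirectedGraph V E} {u v x : V} {p : List E}
    (h : G.IsPath u p v) (hx : x ∈ u :: p.map G.tgt) : ∃ q, G.IsPath x q v ∧ q ⊆ p := by
  induction p generalizing u with
  | nil =>
    obtain rfl : x = u := by simpa using hx
    exact ⟨[], h, by simp⟩
  | cons e p ih =>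
    rcases List.mem_cons.1 hx with rfl | hx
    · exact ⟨_, h, List.Subset.refl _⟩
    · obtain ⟨q, hq, hqp⟩ := ih ⟨h.1.2, (List.nodup_cons.1 h.2).2⟩ hx
      exact ⟨q, hq, List.subset_cons_of_subset _ hqp⟩

/-- Every walk can be shortened to a path. -/
theorem IsWalk.exists_isPath {G : DirectedGraph V E} {u v : V} {p : List E}
    (h : G.IsWalk u p v) : ∃ q, G.IsPath u q v ∧ q ⊆ p := by
  induction p generalizing u with
  | nil => exact ⟨[], ⟨h, by simp⟩, by simp⟩
  | cons e p ih =>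
    obtain ⟨hu, h⟩ := h
    obtain ⟨q, hq, hqp⟩ := ih h
    by_cases hx : u ∈ G.tgt e :: q.map G.tgt
    · obtain ⟨r, hr, hrq⟩ := hq.exists_suffix hx
      exact ⟨r, hr, List.subset_cons_of_subset _ (List.Subset.trans hrq hqp)⟩
    · exact ⟨e :: q, ⟨⟨hu, hq.1⟩, List.nodup_cons.2 ⟨hx, hq.2⟩⟩, List.cons_subset_cons e hqp⟩

/-- A walk that leaves a vertex of positive excess and never reuses an edge can only get stuck at
`t`, if `t` is the only vertex of negative excess. -/
theorem exists_trail_of_excess_pos [DecidableEq E] {t : V} (A : Finset E) {u : V}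
    (hu : 0 < G.excess A u) (hA : ∀ x, x ≠ t → 0 ≤ G.excess A x) :
    ∃ p : List E, p.Nodup ∧ (∀ e ∈ p, e ∈ A) ∧ G.IsWalk u p t := by
  classical
  induction A using Finset.strongInduction generalizing u with
  | H A ih =>
  by_cases hut : u = t
  · exact ⟨[], by simp, by simp, hut⟩
  obtain ⟨e, heA, rfl⟩ : ∃ e ∈ A, G.src e = u := by
    by_contra! hne
    refine hu.not_ge ?_
    rw [excess, Finsupp.finsetSum_apply]
    refine Finset.sum_nonpos fun e he => ?_
    simp only [boundary, Finsupp.sub_apply, Finsupp.single_apply, if_neg (hne e he)]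
    split_ifs <;> simp
  by_cases hv : G.tgt e = t
  · exact ⟨[e], by simp, by simpa using heA, rfl, hv⟩
  have hex : ∀ x, G.excess (A.erase e) x =
      G.excess A x - (if G.src e = x then 1 else 0) + (if G.tgt e = x then 1 else 0) := by
    intro x
    have : G.excess A = G.boundary e + G.excess (A.erase e) :=
      (Finset.add_sum_erase A _ heA).symm
    rw [this]
    simp only [boundary, Finsupp.add_apply, Finsupp.sub_apply, Finsupp.single_apply]
    ring
  obtain ⟨p, hp, hpA, hw⟩ := ih (A.erase e) (Finset.erase_ssubset heA) (u := G.tgt e)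
    (by
      have := hA _ hv
      rw [hex]
      by_cases h : G.src e = G.tgt e
      · rw [h] at hu; simpa [h] using hu
      · simp only [if_neg h, if_true]; omega)
    (by
      intro x hx
      have := hA x hx
      rw [hex]
      by_cases h : G.src e = x
      · subst h; split_ifs <;> omega
      · split_ifs <;> omega)
  refine ⟨e :: p, List.nodup_cons.2 ⟨fun h => ?_, hp⟩, ?_, rfl, hw⟩
  · exact Finset.notMem_erase e A (hpA e h)
  · intro f hf
    rcases List.mem_cons.1 hf with rfl | hf
    · exact heA
    · exact Finset.mem_of_mem_erase (hpA f hf)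

/-- Every edge of a circulation lies on a closed trail. -/
theorem exists_closed_trail_of_excess_eq_zero [DecidableEq E] {A : Finset E}
    (hA : G.excess A = 0) {e : E} (he : e ∈ A) :
    ∃ u p, p.Nodup ∧ (∀ f ∈ p, f ∈ A) ∧ e ∈ p ∧ G.IsWalk u p u := by
  classical
  by_cases hl : G.tgt e = G.src e
  · exact ⟨G.src e, [e], by simp, by simpa using he, by simp, rfl, hl⟩
  have hex : G.excess (A.erase e) =
      Finsupp.single (G.tgt e) 1 - Finsupp.single (G.src e) 1 := by
    have : G.boundary e + G.excess (A.erase e) = 0 := by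
      rw [← hA]; exact Finset.add_sum_erase A _ he
    rw [eq_neg_of_add_eq_zero_right this, boundary, neg_sub]
  obtain ⟨p, hp, hpA, hw⟩ := G.exists_trail_of_excess_pos (t := G.src e) (A.erase e)
    (u := G.tgt e) (by simp [hex, Ne.symm hl]) (by
      intro x hx
      rw [hex]
      simp only [Finsupp.sub_apply, Finsupp.single_apply, if_neg hx.symm]
      split_ifs <;> simp)
  refine ⟨G.src e, e :: p, List.nodup_cons.2 ⟨fun h => ?_, hp⟩, ?_, by simp, rfl, hw⟩
  · exact Finset.notMem_erase e A (hpA e h)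
  · intro f hf
    rcases List.mem_cons.1 hf with rfl | hf
    · exact he
    · exact Finset.mem_of_mem_erase (hpA f hf)

/-- Flow decomposition. Only lower bounds on the excess are needed away from `t`, so the lemma also
applies to what a trail from `s` leaves of a flow when the trail does not end in `t`. -/
theorem exists_edgeDisjointPaths [DecidableEq E] {s t : V} (hst : s ≠ t) (n : ℕ) (A : Finset E)
    (hs : (n : ℤ) ≤ G.excess A s) (hA : ∀ x, x ≠ t → 0 ≤ G.excess A x) :
    ∃ P : Fin n → List E, G.EdgeDisjointPaths s t P ∧ pathsUnion P ⊆ A := by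
  classical
  induction n generalizing A with
  | zero => exact ⟨fun _ => [], ⟨fun i => i.elim0, fun i => i.elim0⟩, by simp [pathsUnion]⟩
  | succ n ih =>
    push_cast at hs
    obtain ⟨q, -, hqA, hqw⟩ := G.exists_trail_of_excess_pos A (u := s) (by omega) hA
    obtain ⟨p, hp, hpq⟩ := hqw.exists_isPath
    have hpA : p.toFinset ⊆ A := fun e he => hqA e (hpq (List.mem_toFinset.1 he))
    have hex : ∀ x, G.excess (A \ p.toFinset) x =
        G.excess A x - ((if s = x then 1 else 0) - (if t = x then 1 else 0)) := by
      intro x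
      rw [G.excess_sdiff hpA, hp.1.excess_toFinset hp.nodup]
      simp [Finsupp.single_apply]
    obtain ⟨P, hP, hPA⟩ := ih (A \ p.toFinset)
      (by rw [hex, if_pos rfl, if_neg hst.symm]; omega)
      (by
        intro x hx
        have := hA x hx
        rw [hex, if_neg hx.symm]
        by_cases h : s = x
        · subst h; simp; omega
        · simpa [h] using this)
    have hdisj : ∀ i, p.Disjoint (P i) := by
      intro i e hep hei
      have : e ∈ A \ p.toFinset :=
        hPA (Finset.mem_biUnion.2 ⟨i, Finset.mem_univ _, List.mem_toFinset.2 hei⟩)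
      exact (Finset.mem_sdiff.1 this).2 (List.mem_toFinset.2 hep)
    refine ⟨Fin.cons p P, ⟨?_, ?_⟩, ?_⟩
    · intro i
      refine Fin.cases ?_ (fun i => ?_) i
      · simpa using hp
      · simpa using hP.1 i
    · intro i j
      refine Fin.cases ?_ (fun i => ?_) i <;> refine Fin.cases ?_ (fun j => ?_) j
      · simp
      · intro _
        simpa using hdisj j
      · intro _
        simpa using (hdisj i).symm
      · intro hij
        simpa using hP.2 i j (fun h => hij (by rw [h]))
    · intro e he
      obtain ⟨i, -, hi⟩ := Finset.mem_biUnion.1 he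
      revert hi
      refine Fin.cases (fun hi => ?_) (fun i hi => ?_) i
      · exact hpA (by simpa using hi)
      · exact (Finset.mem_sdiff.1 (hPA (Finset.mem_biUnion.2
          ⟨i, Finset.mem_univ _, by simpa using hi⟩))).1

theorem EdgeDisjointPaths.excess_pathsUnion [DecidableEq E] {G : DirectedGraph V E} {s t : V} {n : ℕ}
    {P : Fin n → List E} (hP : G.EdgeDisjointPaths s t P) :
    G.excess (pathsUnion P) = n • (Finsupp.single s 1 - Finsupp.single t 1) := by
  rw [excess, pathsUnion, Finset.sum_biUnion]
  · have : ∀ i, ∑ e ∈ (P i).toFinset, G.boundary e = Finsupp.single s 1 - Finsupp.single t 1 :=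
      fun i => (hP.1 i).1.excess_toFinset (hP.1 i).nodup
    rw [Finset.sum_congr rfl fun i _ => this i, Finset.sum_const, Finset.card_univ,
      Fintype.card_fin]
  · intro i _ j _ hij
    rw [Function.onFun, Finset.disjoint_left]
    intro e hi hj
    exact hP.2 i j hij (List.mem_toFinset.1 hi) (List.mem_toFinset.1 hj)

/-- An `n`-flow, given by its excess, contains the union of `n` edge-disjoint paths. -/
theorem exists_edgeDisjointPaths_of_excess_eq [DecidableEq E] {s t : V} (hst : s ≠ t) {n : ℕ}
    {A : Finset E} (hA : G.excess A = n • (Finsupp.single s 1 - Finsupp.single t 1)) :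
    ∃ P : Fin n → List E, G.EdgeDisjointPaths s t P ∧ pathsUnion P ⊆ A := by
  classical
  refine G.exists_edgeDisjointPaths hst n A (by simp [hA, hst]) fun x hx => ?_
  simp only [hA, Finsupp.smul_apply, Finsupp.sub_apply, Finsupp.single_apply, if_neg hx.symm]
  split_ifs <;> simp

/-- Potentials from the absence of negative closed trails: the least cost of a trail in `A` that
ends at `v`. -/
theorem exists_potential [Finite E] {M : Type*} [AddCommGroup M] [LinearOrder M] [IsOrderedAddMonoid M]
    (A : Finset E) (cost : E → M)
    (hcost : ∀ u p, p.Nodup → (∀ e ∈ p, e ∈ A) → G.IsWalk u p u → 0 ≤ (p.map cost).sum) :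
    ∃ π : V → M, (∀ e ∈ A, π (G.tgt e) ≤ π (G.src e) + cost e) ∧ (∀ v, π v ≤ 0) ∧
      ∀ v, ∃ u p, p.Nodup ∧ (∀ e ∈ p, e ∈ A) ∧ G.IsWalk u p v ∧ π v = (p.map cost).sum := by
  classical
  let trails : V → Set (List E) := fun v =>
    {p | p.Nodup ∧ (∀ e ∈ p, e ∈ A) ∧ ∃ u, G.IsWalk u p v}
  have hfin : ∀ v, (trails v).Finite := fun v =>
    (List.finite_length_le E A.card).subset fun p hp => by
      rw [Set.mem_ofPred_eq, ← List.toFinset_card_of_nodup hp.1]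
      exact Finset.card_le_card fun e he => hp.2.1 e (List.mem_toFinset.1 he)
  have hne : ∀ v, [] ∈ trails v := fun v => ⟨by simp, by simp, v, rfl⟩
  have hmin : ∀ v, ∃ p ∈ trails v, ∀ q ∈ trails v, (p.map cost).sum ≤ (q.map cost).sum :=
    fun v => Set.exists_min_image _ _ (hfin v) ⟨_, hne v⟩
  choose q hq hqmin using hmin
  refine ⟨fun v => ((q v).map cost).sum, fun e he => ?_, fun v => ?_, fun v => ?_⟩
  · obtain ⟨hnd, hA, u, hw⟩ := hq (G.src e)
    show ((q (G.tgt e)).map cost).sum ≤ ((q (G.src e)).map cost).sum + cost e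
    by_cases hmem : e ∈ q (G.src e)
    · -- The part of the trail after `e`, closed up by `e`, is a closed trail.
      obtain ⟨p₁, p₂, hp⟩ := List.append_of_mem hmem
      rw [hp] at hnd hA hw ⊢
      obtain ⟨m, hw₁, rfl, hw₂⟩ := (G.isWalk_append).1 hw
      have h1 := hqmin (G.tgt e) (p₁ ++ [e]) ⟨?_, ?_, u, (G.isWalk_append).2 ⟨_, hw₁, rfl, rfl⟩⟩
      · have h2 := hcost (G.src e) (e :: p₂) (List.nodup_append.1 hnd).2.1
          (fun f hf => hA f (List.mem_append_right _ hf)) ⟨rfl, hw₂⟩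
        simp only [List.map_append, List.sum_append, List.map_cons, List.sum_cons, List.map_nil,
          List.sum_nil, add_zero] at h1 h2 ⊢
        calc _ ≤ _ := h1
          _ ≤ _ := by
            have := add_le_add_right h2 ((p₁.map cost).sum + cost e)
            rw [add_zero] at this
            refine this.trans (le_of_eq ?_)
            abel
      · refine hnd.sublist ?_
        simp
      · intro f hf
        refine hA f ?_
        simp only [List.mem_append, List.mem_cons, List.not_mem_nil, or_false] at hf ⊢
        tauto
    · have h1 := hqmin (G.tgt e) (q (G.src e) ++ [e])
        ⟨?_, ?_, u, (G.isWalk_append).2 ⟨_, hw, rfl, rfl⟩⟩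
      · simpa using h1
      · rw [List.nodup_append]
        refine ⟨hnd, by simp, ?_⟩
        rintro f hf g hg rfl
        rw [List.mem_singleton.1 hg] at hf
        exact hmem hf
      · intro f hf
        rcases List.mem_append.1 hf with hf | hf
        · exact hA f hf
        · rwa [List.mem_singleton.1 hf]
  · simpa using hqmin v [] (hne v)
  · obtain ⟨hnd, hA, u, hw⟩ := hq v
    exact ⟨u, q v, hnd, hA, hw, rfl⟩

end DirectedGraph

/-! ### The lower bound on the benchmark -/

theorem Finset.sum_symmDiff_eq {E M : Type*} [DecidableEq E] [AddCommGroup M] (S D : Finset E)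
    (g : E → M) :
    ∑ e ∈ symmDiff S D, g e = ∑ e ∈ S, g e + ∑ e ∈ D, if e ∈ S then - g e else g e := by
  have h1 : ∑ e ∈ symmDiff S D, g e = ∑ e ∈ S \ D, g e + ∑ e ∈ D \ S, g e := by
    rw [symmDiff, Finset.sup_eq_union, Finset.sum_union]
    exact disjoint_sdiff_sdiff
  have h2 : ∑ e ∈ S, g e = ∑ e ∈ S \ D, g e + ∑ e ∈ D ∩ S, g e := by
    rw [Finset.inter_comm, add_comm, Finset.sum_inter_add_sum_sdiff]
  have h3 : ∑ e ∈ D, (if e ∈ S then - g e else g e) =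
      ∑ e ∈ D ∩ S, - g e + ∑ e ∈ D \ S, g e := by
    rw [← Finset.sum_inter_add_sum_sdiff D S]
    congr 1
    · exact Finset.sum_congr rfl fun e he => if_pos (Finset.mem_inter.1 he).2
    · exact Finset.sum_congr rfl fun e he => if_neg (Finset.mem_sdiff.1 he).2
  rw [h1, h2, h3, Finset.sum_neg_distrib]
  abel

theorem Finset.sum_eraseNone_add {E M : Type*} [DecidableEq E] [AddCommMonoid M]
    (s : Finset (Option E)) (f : Option E → M) :
    ∑ a ∈ s, f a = ∑ e ∈ Finset.eraseNone s, f (some e) + if none ∈ s then f none else 0 := by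
  have h : ∑ e ∈ Finset.eraseNone s, f (some e) = ∑ a ∈ s.erase none, f a := by
    rw [← Finset.map_some_eraseNone, Finset.sum_map]
    rfl
  rw [h]
  split_ifs with hn
  · rw [Finset.sum_erase_add _ _ hn]
  · rw [Finset.erase_eq_of_notMem hn, add_zero]

namespace DirectedGraph

variable {V E : Type*}

/-- A potential difference sums over a flow to the value of the flow times the potential
difference between `s` and `t`. -/
theorem sum_potential (G : DirectedGraph V E) {s t : V} {k : ℕ} {S : Finset E}
    (hS : G.excess S = k • (Finsupp.single s 1 - Finsupp.single t 1)) (π : V → ℝ) :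
    ∑ e ∈ S, (π (G.tgt e) - π (G.src e)) = k * (π t - π s) := by
  have h := congrArg (Finsupp.liftAddHom fun v => (AddMonoidHom.mulRight (π v)).comp
    (Int.castAddHom ℝ)) hS
  simp only [excess, boundary, map_sum, map_nsmul, map_sub, Finsupp.liftAddHom_apply_single,
    AddMonoidHom.comp_apply, Int.coe_castAddHom, Int.cast_one, AddMonoidHom.mulRight_apply, one_mul,
    nsmul_eq_mul, Finset.sum_sub_distrib] at h
  rw [Finset.sum_sub_distrib]
  linarith

variable [DecidableEq E]

/-- The residual graph of `S`, in which the edges of `S` are reversed, together with one more edge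
`none` from `t` to `s`. -/
def residual (G : DirectedGraph V E) (S : Finset E) (s t : V) : DirectedGraph V (Option E) where
  src a := a.elim t fun e => if e ∈ S then G.tgt e else G.src e
  tgt a := a.elim s fun e => if e ∈ S then G.src e else G.tgt e

theorem residual_boundary_some (G : DirectedGraph V E) (S : Finset E) (s t : V) (e : E) :
    (G.residual S s t).boundary (some e) = if e ∈ S then - G.boundary e else G.boundary e := by
  by_cases h : e ∈ S <;> simp [residual, boundary, h]

/-- Optimality of a `k`-flow `S` in terms of potentials. If moreover every union of `k + 1`
edge-disjoint paths costs at least `δ` more than `S`, then the potential difference between `s` and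
`t` can be chosen to be at least `δ`: augmenting `S` along a closed trail of the residual graph
that uses the extra edge gives a `(k + 1)`-flow, and along any other closed trail a `k`-flow. -/
theorem exists_potential_of_isCheapest [Finite E] (G : DirectedGraph V E) {s t : V} (hst : s ≠ t)
    {k : ℕ} {S : Finset E} (hS : G.excess S = k • (Finsupp.single s 1 - Finsupp.single t 1))
    (c : E → ℝ) (hc : ∀ e, 0 ≤ c e) {δ : ℝ}
    (hk : ∀ T ∈ G.kPathsSystem s t k, ∑ e ∈ S, c e ≤ ∑ e ∈ T, c e)
    (hk' : ∀ T ∈ G.pathUnions s t (k + 1), ∑ e ∈ S, c e + δ ≤ ∑ e ∈ T, c e) :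
    ∃ π : V → ℝ, (∀ e ∈ S, c e ≤ π (G.tgt e) - π (G.src e)) ∧
      (∀ e ∉ S, π (G.tgt e) - π (G.src e) ≤ c e) ∧ δ ≤ π t - π s := by
  classical
  have := Fintype.ofFinite E
  let cost : Option E → ℝ := fun a => a.elim (-δ) fun e => if e ∈ S then - c e else c e
  obtain ⟨π, hπ, -, -⟩ := (G.residual S s t).exists_potential Finset.univ cost (by
    intro u p hp _ hw
    set D := Finset.eraseNone p.toFinset with hD
    have hcost : (p.map cost).sum = (∑ e ∈ symmDiff S D, c e - ∑ e ∈ S, c e) +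
        if none ∈ p.toFinset then -δ else 0 := by
      rw [← List.sum_toFinset _ hp, Finset.sum_eraseNone_add, Finset.sum_symmDiff_eq]
      simp [hD]
    have hex : G.excess (symmDiff S D) + (if none ∈ p.toFinset then
        Finsupp.single t 1 - Finsupp.single s 1 else 0) = G.excess S := by
      have h0 := hw.excess_toFinset hp
      rw [excess, Finset.sum_eraseNone_add, sub_self] at h0
      simp only [residual_boundary_some] at h0
      have hn : (G.residual S s t).boundary none = Finsupp.single t 1 - Finsupp.single s 1 := rfl
      rw [hn] at h0
      rw [excess, Finset.sum_symmDiff_eq, add_assoc, h0, add_zero, excess]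
    rw [hcost]
    split_ifs with hn
    · rw [if_pos hn, hS] at hex
      obtain ⟨P, hP, hPT⟩ := G.exists_edgeDisjointPaths_of_excess_eq hst (n := k + 1)
        (A := symmDiff S D) (by rw [eq_sub_of_add_eq hex, succ_nsmul]; abel)
      have h1 := hk' _ ⟨P, hP, rfl⟩
      have h2 := Finset.sum_le_sum_of_subset_of_nonneg hPT fun e _ _ => hc e
      linarith
    · rw [if_neg hn, hS, add_zero] at hex
      have h1 := hk _ (G.exists_edgeDisjointPaths_of_excess_eq hst hex)
      linarith)
  refine ⟨π, fun e he => ?_, fun e he => ?_, ?_⟩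
  · have := hπ (some e) (Finset.mem_univ _)
    simp only [residual, cost, Option.elim_some, if_pos he] at this
    linarith
  · have := hπ (some e) (Finset.mem_univ _)
    simp only [residual, cost, Option.elim_some, if_neg he] at this
    linarith
  · have := hπ none (Finset.mem_univ _)
    simp only [residual, cost, Option.elim_none] at this
    linarith

end DirectedGraph

/-- Every bid vector that satisfies the first two constraints of the benchmark bounds it from below:
a bid vector of largest total among those satisfying them has all constraints tight that the third
constraint asks for, as otherwise some bid could be raised. -/
theorem le_benchmarkMu {E : Type*} [Finite E] [DecidableEq E] {F : Set (Finset E)}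
    (hF : MonopolyFree F) {c : E → ℝ≥0} {S : Finset E} {b₀ : E → ℝ≥0} (hb₀ : ∀ e, c e ≤ b₀ e)
    (hb₀' : ∀ T ∈ F, ∑ e ∈ S \ T, b₀ e ≤ ∑ e ∈ T \ S, c e) :
    ((∑ e ∈ S, b₀ e : ℝ≥0) : ℝ≥0∞) ≤ benchmarkMu F c S := by
  have := Fintype.ofFinite E
  let K : Set (E → ℝ≥0) := {b | ∀ e, c e ≤ b e} ∩
    {b | ∀ T ∈ F, ∑ e ∈ S \ T, b e ≤ ∑ e ∈ T \ S, c e} ∩ {b | ∀ e ∉ S, b e = b₀ e}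
  have hclosed : IsClosed K := by
    refine (IsClosed.inter ?_ ?_).inter ?_
    · simp only [Set.ofPred_forall]
      exact isClosed_iInter fun e => isClosed_le continuous_const (continuous_apply e)
    · simp only [Set.ofPred_forall]
      exact isClosed_iInter fun T => isClosed_iInter fun _ => isClosed_le
        (continuous_finsetSum _ fun e _ => continuous_apply e) continuous_const
    · simp only [Set.ofPred_forall]
      exact isClosed_iInter fun e => isClosed_iInter fun _ =>
        isClosed_eq (continuous_apply e) continuous_const
  have hbdd : K ⊆ Set.Icc 0 fun e => b₀ e + ∑ e, c e := by
    rintro b ⟨⟨-, hb⟩, hb'⟩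
    refine ⟨zero_le, fun e => ?_⟩
    by_cases he : e ∈ S
    · obtain ⟨T, hT, heT⟩ := hF e
      calc b e ≤ ∑ e ∈ S \ T, b e :=
            Finset.single_le_sum (f := b) (fun _ _ => zero_le)
              (Finset.mem_sdiff.2 ⟨he, heT⟩)
        _ ≤ ∑ e ∈ T \ S, c e := hb T hT
        _ ≤ ∑ e, c e := Finset.sum_le_sum_of_subset (Finset.subset_univ _)
        _ ≤ _ := le_add_self
    · rw [hb' e he]
      exact le_self_add
  obtain ⟨b, ⟨⟨hbc, hbF⟩, hbS⟩, hmax⟩ := (isCompact_Icc.of_isClosed_subset hclosed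
    hbdd).exists_isMaxOn ⟨b₀, ⟨hb₀, hb₀'⟩, fun _ _ => rfl⟩
    (f := fun b => ∑ e ∈ S, b e)
    (continuous_finsetSum _ fun e _ => continuous_apply e).continuousOn
  refine le_trans (ENNReal.coe_le_coe.2 (hmax (a := b₀) ⟨⟨hb₀, hb₀'⟩, fun _ _ => rfl⟩)) ?_
  refine le_iSup₂_of_le b ⟨hbc, hbF, fun e he => ?_⟩ le_rfl
  by_contra! hne
  -- `T₀` has the least slack among the feasible sets that avoid `e`; the bid of `e` can be
  -- raised by this slack.
  obtain ⟨T₀, ⟨hT₀, heT₀⟩, hmin⟩ := Set.exists_min_image {T | T ∈ F ∧ e ∉ T}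
    (fun T => ∑ e ∈ T \ S, c e - ∑ e ∈ S \ T, b e) (Set.toFinite _) (hF e)
  set ε := ∑ e ∈ T₀ \ S, c e - ∑ e ∈ S \ T₀, b e with hε
  have hεpos : 0 < ε := tsub_pos_of_lt (lt_of_le_of_ne (hbF T₀ hT₀) (hne T₀ hT₀ heT₀))
  have hupd : ∀ U : Finset E, e ∈ U →
      ∑ f ∈ U, Function.update b e (b e + ε) f = ∑ f ∈ U, b f + ε := by
    intro U hU
    rw [Finset.sum_update_of_mem hU, ← Finset.add_sum_erase U b hU, Finset.sdiff_singleton_eq_erase]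
    ring
  have hmem : Function.update b e (b e + ε) ∈ K := by
    refine ⟨⟨fun f => ?_, fun T hT => ?_⟩, fun f hf => ?_⟩
    · refine (hbc f).trans ?_
      by_cases hfe : f = e
      · subst hfe; simp
      · simp [hfe]
    · by_cases heT : e ∈ T
      · rw [Finset.sum_update_of_notMem (by simp [heT])]
        exact hbF T hT
      · rw [hupd _ (Finset.mem_sdiff.2 ⟨he, heT⟩)]
        calc _ ≤ ∑ e ∈ S \ T, b e + (∑ e ∈ T \ S, c e - ∑ e ∈ S \ T, b e) := by
              gcongr; exact hmin T ⟨hT, heT⟩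
          _ = _ := add_tsub_cancel_of_le (hbF T hT)
    · rw [Function.update_of_ne (by rintro rfl; exact hf he)]
      exact hbS f hf
  have h := hmax hmem
  simp only [Set.mem_ofPred_eq] at h
  rw [hupd S he] at h
  exact absurd h (not_le.2 (lt_add_of_pos_right _ hεpos))

/-- The benchmark of a `k`-paths system is at least `k` times the difference between the cheapest
costs of `k + 1` and of `k` edge-disjoint paths: bid the potential differences on a `k`-flow. -/
theorem DirectedGraph.le_benchmarkMu_kPathsSystem {V E : Type*} [Fintype E] [DecidableEq E]
    (G : DirectedGraph V E) {s t : V} (hst : s ≠ t) {k : ℕ}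
    (hG : MonopolyFree (G.kPathsSystem s t k)) {c : E → ℝ≥0} {S A : Finset E}
    (hS : IsCheapest (G.kPathsSystem s t k) c S) (hA : IsCheapest (G.pathUnions s t (k + 1)) c A) :
    ENNReal.ofReal (k * (∑ e ∈ A, (c e : ℝ) - ∑ e ∈ S, (c e : ℝ))) ≤
      benchmarkMu (G.kPathsSystem s t k) c S := by
  have hcheap : ∀ T ∈ G.kPathsSystem s t k, ∑ e ∈ S, (c e : ℝ) ≤ ∑ e ∈ T, (c e : ℝ) :=
    fun T hT => by exact_mod_cast hS.2 T hT
  obtain ⟨P, hP, hPS⟩ := hS.1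
  set S' := pathsUnion P with hS'
  have hex : G.excess S' = k • (Finsupp.single s 1 - Finsupp.single t 1) := hP.excess_pathsUnion
  have hsplit : ∑ e ∈ S \ S', (c e : ℝ) + ∑ e ∈ S', (c e : ℝ) = ∑ e ∈ S, (c e : ℝ) :=
    Finset.sum_sdiff hPS
  have hle := hcheap S' ⟨P, hP, subset_rfl⟩
  have hnn : 0 ≤ ∑ e ∈ S \ S', (c e : ℝ) := Finset.sum_nonneg fun e _ => (c e).2
  -- The edges of `S` outside the `k` paths are free.
  have hzero : ∀ e ∈ S, e ∉ S' → c e = 0 := by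
    intro e he he'
    have := (Finset.sum_eq_zero_iff_of_nonneg fun e _ => (c e).2).1
      (show ∑ e ∈ S \ S', (c e : ℝ) = 0 by linarith) e (Finset.mem_sdiff.2 ⟨he, he'⟩)
    exact NNReal.coe_eq_zero.1 this
  obtain ⟨π, hπ, hπ', hδ⟩ := G.exists_potential_of_isCheapest hst hex (fun e => (c e : ℝ))
    (fun e => (c e).2) (δ := ∑ e ∈ A, (c e : ℝ) - ∑ e ∈ S, (c e : ℝ))
    (fun T hT => by linarith [hcheap T hT])
    (fun T hT => by
      have : ∑ e ∈ A, (c e : ℝ) ≤ ∑ e ∈ T, (c e : ℝ) := by exact_mod_cast hA.2 T hT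
      linarith)
  let b : E → ℝ≥0 := fun e => if e ∈ S' then (π (G.tgt e) - π (G.src e)).toNNReal else c e
  have hb : ∀ e ∈ S', (b e : ℝ) = π (G.tgt e) - π (G.src e) := fun e he => by
    simp only [b, if_pos he]
    exact Real.coe_toNNReal _ ((c e).2.trans (hπ e he))
  have hb' : ∀ e ∉ S', b e = c e := fun e he => if_neg he
  have hbc : ∀ e, c e ≤ b e := fun e => by
    by_cases he : e ∈ S'
    · exact NNReal.coe_le_coe.1 ((hb e he).symm ▸ hπ e he)
    · exact (hb' e he).ge
  -- Every feasible set contains a `k`-flow, whose potential differences sum to those of `S'`.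
  have hund : ∀ T ∈ G.kPathsSystem s t k, ∑ e ∈ S \ T, b e ≤ ∑ e ∈ T \ S, c e := by
    rintro T ⟨Q, hQ, hQT⟩
    have h1 : ∑ e ∈ S', (π (G.tgt e) - π (G.src e)) =
        ∑ e ∈ pathsUnion Q, (π (G.tgt e) - π (G.src e)) := by
      rw [G.sum_potential hex, G.sum_potential hQ.excess_pathsUnion]
    rw [← Finset.sum_inter_add_sum_sdiff S' (pathsUnion Q),
      ← Finset.sum_inter_add_sum_sdiff (pathsUnion Q) S', Finset.inter_comm, add_right_inj] at h1
    have h2 : ∑ e ∈ pathsUnion Q \ S', (π (G.tgt e) - π (G.src e)) ≤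
        ∑ e ∈ pathsUnion Q \ S', (c e : ℝ) :=
      Finset.sum_le_sum fun e he => hπ' e (Finset.mem_sdiff.1 he).2
    have h3 : ∑ e ∈ S' \ pathsUnion Q, (b e : ℝ) ≤ ∑ e ∈ pathsUnion Q \ S', (c e : ℝ) := by
      rw [Finset.sum_congr rfl fun e he => hb e (Finset.mem_sdiff.1 he).1, h1]
      exact h2
    have h4 : ∑ e ∈ S' \ pathsUnion Q, b e ≤ ∑ e ∈ pathsUnion Q \ S', c e := by exact_mod_cast h3
    calc ∑ e ∈ S \ T, b e ≤ ∑ e ∈ S' \ pathsUnion Q, b e := by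
          refine Finset.sum_le_sum_of_ne_zero fun e he hne => ?_
          obtain ⟨heS, heT⟩ := Finset.mem_sdiff.1 he
          refine Finset.mem_sdiff.2 ⟨?_, fun h => heT (hQT h)⟩
          by_contra heS'
          exact hne ((hb' e heS').trans (hzero e heS heS'))
      _ ≤ _ := h4
      _ ≤ ∑ e ∈ T \ S, c e := by
          refine Finset.sum_le_sum_of_ne_zero fun e he hne => ?_
          obtain ⟨heQ, heS'⟩ := Finset.mem_sdiff.1 he
          exact Finset.mem_sdiff.2 ⟨hQT heQ, fun h => hne (hzero e h heS')⟩
  refine le_trans ?_ (le_benchmarkMu hG hbc hund)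
  rw [ENNReal.ofReal_le_iff_le_toReal ENNReal.coe_ne_top, ENNReal.coe_toReal, NNReal.coe_sum]
  calc _ ≤ (k : ℝ) * (π t - π s) := by gcongr
    _ = ∑ e ∈ S', (b e : ℝ) := by
        rw [← G.sum_potential hex]
        exact Finset.sum_congr rfl fun e he => (hb e he).symm
    _ ≤ _ := Finset.sum_le_sum_of_subset_of_nonneg hPS fun e _ _ => (b e).2

/-! ### Independent sets of the dependency graph -/

namespace DirectedGraph

variable {V E : Type*} (G : DirectedGraph V E)

open Classical in
/-- The edges of `A` that lie on a closed trail in `A`. -/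
noncomputable def cyclicEdges (A : Finset E) : Finset E :=
  {e ∈ A | ∃ u p, p.Nodup ∧ (∀ f ∈ p, f ∈ A) ∧ e ∈ p ∧ G.IsWalk u p u}

theorem IsWalk.potential_le {G : DirectedGraph V E} {M : Type*} [AddCommMonoid M] [PartialOrder M]
    [IsOrderedAddMonoid M] {π : V → M} {cost : E → M} {A : Finset E}
    (hπ : ∀ e ∈ A, π (G.tgt e) ≤ π (G.src e) + cost e) {u v : V} {p : List E}
    (h : G.IsWalk u p v) (hp : ∀ e ∈ p, e ∈ A) : π v ≤ π u + (p.map cost).sum := by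
  induction p generalizing u with
  | nil => obtain rfl : u = v := h; simp
  | cons e p ih =>
    obtain ⟨rfl, h⟩ := h
    rw [List.map_cons, List.sum_cons, ← add_assoc]
    exact (ih h fun f hf => hp f (List.mem_cons_of_mem _ hf)).trans
      (add_le_add_left (hπ e (hp e List.mem_cons_self)) _)

variable [DecidableEq E]

/-- Two edges of a `(k + 1)`-flow `A` that do not lie on closed trails and are both avoided by a
`k`-flow in `A` lie on a common trail. -/
theorem exists_trail_of_avoiding {s t : V} {k : ℕ} {A : Finset E}
    (hA : G.excess A = (k + 1) • (Finsupp.single s 1 - Finsupp.single t 1)) (hst : s ≠ t)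
    {T : Finset E} (hT : T ∈ G.kPathsSystem s t k) (hTA : T ⊆ A) :
    ∃ u v p, p.Nodup ∧ (∀ e ∈ p, e ∈ A) ∧ G.IsWalk u p v ∧
      ∀ e ∈ A, e ∉ T → e ∉ G.cyclicEdges A → e ∈ p := by
  classical
  obtain ⟨P, hP, hPT⟩ := hT
  have hex : G.excess (A \ pathsUnion P) = Finsupp.single s 1 - Finsupp.single t 1 := by
    rw [G.excess_sdiff (hPT.trans hTA), hA, hP.excess_pathsUnion, succ_nsmul]
    abel
  obtain ⟨p, hp, hpB, hw⟩ := G.exists_trail_of_excess_pos (t := t) (A \ pathsUnion P) (u := s)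
    (by simp [hex, hst]) (by
      intro x hx
      rw [hex]
      simp only [Finsupp.sub_apply, Finsupp.single_apply, if_neg hx.symm]
      split_ifs <;> simp)
  refine ⟨s, t, p, hp, fun e he => (Finset.mem_sdiff.1 (hpB e he)).1, hw, fun e heA heT hcyc => ?_⟩
  by_contra hep
  have hex' : G.excess ((A \ pathsUnion P) \ p.toFinset) = 0 := by
    rw [G.excess_sdiff fun f hf => hpB f (List.mem_toFinset.1 hf), hex, hw.excess_toFinset hp,
      sub_self]
  obtain ⟨u, q, hq, hqA, heq, hqw⟩ := G.exists_closed_trail_of_excess_eq_zero hex' (e := e)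
    (by simp only [Finset.mem_sdiff, List.mem_toFinset]
        exact ⟨⟨heA, fun h => heT (hPT h)⟩, hep⟩)
  exact hcyc (Finset.mem_filter.2 ⟨heA, u, q, hq, fun f hf =>
    (Finset.mem_sdiff.1 (Finset.mem_sdiff.1 (hqA f hf)).1).1, heq, hqw⟩)

/-- If the edges of `R` are pairwise avoidable, then they lie on a common trail: the largest number
of edges of `R` on a trail that ends in a given vertex is different for the heads of all edges of
`R`, hence reaches the size of `R`. -/
theorem exists_trail_of_pairwise [Finite E] {s t : V} {k : ℕ} {A : Finset E}
    (hA : G.excess A = (k + 1) • (Finsupp.single s 1 - Finsupp.single t 1)) (hst : s ≠ t)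
    {R : Finset E} (hRA : R ⊆ A) (hcyc : ∀ e ∈ R, e ∉ G.cyclicEdges A) (hne : R.Nonempty)
    (hR : ∀ e ∈ R, ∀ f ∈ R, e ≠ f → ∃ T ∈ G.kPathsSystem s t k, T ⊆ A ∧ e ∉ T ∧ f ∉ T) :
    ∃ u v p, p.Nodup ∧ (∀ e ∈ p, e ∈ A) ∧ G.IsWalk u p v ∧ ∀ e ∈ R, e ∈ p := by
  classical
  let cost : E → ℤ := fun e => if e ∈ R then -1 else 0
  have hcost : ∀ e, cost e ≤ 0 := fun e => by simp only [cost]; split_ifs <;> simp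
  have hcard : ∀ p : List E, p.Nodup → (p.map cost).sum = -((p.toFinset ∩ R).card : ℤ) := by
    intro p hp
    rw [← List.sum_toFinset _ hp, Finset.sum_ite_mem]
    simp
  obtain ⟨π, hπ, hπ0, hπt⟩ := G.exists_potential A cost (by
    intro u p hp hpA hw
    rw [hcard p hp, Finset.card_eq_zero.2, Nat.cast_zero, neg_zero]
    refine Finset.eq_empty_of_forall_notMem fun e he => ?_
    obtain ⟨hep, heR⟩ := Finset.mem_inter.1 he
    exact hcyc e heR (Finset.mem_filter.2 ⟨hRA heR, u, p, hp, hpA, List.mem_toFinset.1 hep, hw⟩))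
  have hstep : ∀ e ∈ R, π (G.tgt e) ≤ π (G.src e) - 1 := fun e he => by
    simpa [cost, he, ← sub_eq_add_neg] using hπ e (hRA he)
  have hlt : ∀ e ∈ R, ∀ f ∈ R, ∀ u v l₁ l₂, (∀ g ∈ l₁ ++ e :: l₂, g ∈ A) →
      G.IsWalk u (l₁ ++ e :: l₂) v → f ∈ l₂ → π (G.tgt f) < π (G.tgt e) := by
    intro e he f hf u v l₁ l₂ hl hw hfl
    obtain ⟨l₃, l₄, rfl⟩ := List.append_of_mem hfl
    obtain ⟨m, -, rfl, hw⟩ := (G.isWalk_append).1 hw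
    obtain ⟨m, hw, rfl, -⟩ := (G.isWalk_append).1 hw
    have h1 := hw.potential_le hπ fun g hg => hl g (by simp [hg])
    have h2 : (l₃.map cost).sum ≤ 0 := by
      simpa using List.sum_le_sum (l := l₃) (f := cost) (g := fun _ => 0) fun g _ => hcost g
    have h3 := hstep f hf
    omega
  have hinj : Set.InjOn (fun e => π (G.tgt e)) (R : Set E) := by
    intro e he f hf hef
    by_contra hne
    obtain ⟨T, hT, hTA, heT, hfT⟩ := hR e he f hf hne
    obtain ⟨u, v, p, hp, hpA, hw, hmem⟩ := G.exists_trail_of_avoiding hA hst hT hTA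
    have hep := hmem e (hRA he) heT (hcyc e he)
    have hfp := hmem f (hRA hf) hfT (hcyc f hf)
    obtain ⟨l₁, l₂, rfl⟩ := List.append_of_mem hep
    rcases List.mem_append.1 hfp with h | h
    · obtain ⟨l₃, l₄, rfl⟩ := List.append_of_mem h
      rw [List.append_assoc, List.cons_append] at hpA hw
      exact (hlt f hf e he _ _ _ _ hpA hw (by simp)).ne hef
    · rcases List.mem_cons.1 h with h | h
      · exact hne h.symm
      · exact (hlt e he f hf _ _ _ _ hpA hw h).ne' hef
  obtain ⟨r, hr, hmin⟩ := R.exists_min_image (fun e => π (G.tgt e)) hne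
  obtain ⟨u, p, hp, hpA, hw, hsum⟩ := hπt (G.tgt r)
  refine ⟨u, _, p, hp, hpA, hw, fun e he => ?_⟩
  have h1 : R.card ≤ (Finset.Icc (π (G.tgt r)) (-1)).card := by
    refine Finset.card_le_card_of_injOn (fun e => π (G.tgt e)) (fun e he => ?_) hinj
    have := hstep e he
    have := hπ0 (G.src e)
    exact Finset.mem_coe.2 (Finset.mem_Icc.2 ⟨hmin e he, show π (G.tgt e) ≤ -1 by omega⟩)
  rw [Int.card_Icc, hsum, hcard p hp] at h1
  have h2 : p.toFinset ∩ R = R := Finset.eq_of_subset_of_card_le Finset.inter_subset_right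
    (by omega)
  rw [← h2] at he
  exact List.mem_toFinset.1 (Finset.mem_inter.1 he).1

/-- In a `(k + 1)`-flow, the complement of an independent set of the dependency graph that has no
edge on a closed trail is feasible: the independent set lies on a trail that starts in `s`, whose
removal leaves `k` edge-disjoint paths. -/
theorem sdiff_mem_kPathsSystem [Finite E] {s t : V} {k : ℕ} {A : Finset E}
    (hA : G.excess A = (k + 1) • (Finsupp.single s 1 - Finsupp.single t 1)) (hst : s ≠ t)
    {R : Finset E} (hRA : R ⊆ A) (hcyc : ∀ e ∈ R, e ∉ G.cyclicEdges A)
    (hR : ∀ e ∈ R, ∀ f ∈ R, e ≠ f → ∃ T ∈ G.kPathsSystem s t k, T ⊆ A ∧ e ∉ T ∧ f ∉ T) :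
    A \ R ∈ G.kPathsSystem s t k := by
  classical
  have hAx : ∀ x, G.excess A x = (k + 1) * ((if s = x then 1 else 0) - if t = x then 1 else 0) := by
    intro x
    simp [hA, Finsupp.single_apply]
  rcases R.eq_empty_or_nonempty with rfl | ⟨r, hr⟩
  · refine G.exists_edgeDisjointPaths hst k (A \ ∅) ?_ fun x hx => ?_
    · rw [Finset.sdiff_empty, hAx, if_pos rfl, if_neg hst.symm]
      omega
    · rw [Finset.sdiff_empty, hAx, if_neg hx.symm]
      split_ifs <;> omega
  -- A longest trail containing `R` starts in `s`, since it could be extended otherwise.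
  obtain ⟨p, ⟨⟨hp, hpA, u, v, hw⟩, hRp⟩, hmax⟩ := Set.exists_max_image
    {p : List E | (p.Nodup ∧ (∀ e ∈ p, e ∈ A) ∧ ∃ u v, G.IsWalk u p v) ∧ ∀ e ∈ R, e ∈ p}
    List.length
    ((List.finite_length_le E A.card).subset fun p hp => by
      rw [Set.mem_ofPred_eq, ← List.toFinset_card_of_nodup hp.1.1]
      exact Finset.card_le_card fun e he => hp.1.2.1 e (List.mem_toFinset.1 he))
    (by
      obtain ⟨u, v, p, hp, hpA, hw, hRp⟩ := G.exists_trail_of_pairwise hA hst hRA hcyc ⟨r, hr⟩ hR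
      exact ⟨p, ⟨hp, hpA, u, v, hw⟩, hRp⟩)
  have huv : u ≠ v := by
    rintro rfl
    exact hcyc r hr (Finset.mem_filter.2 ⟨hRA hr, u, p, hp, hpA, hRp r hr, hw⟩)
  have hex : ∀ x, G.excess (A \ p.toFinset) x =
      (k + 1) * ((if s = x then 1 else 0) - if t = x then 1 else 0) -
        ((if u = x then 1 else 0) - if v = x then 1 else 0) := by
    intro x
    rw [G.excess_sdiff fun e he => hpA e (List.mem_toFinset.1 he), hw.excess_toFinset hp,
      Finsupp.sub_apply, hAx]
    simp [Finsupp.single_apply]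
  obtain rfl : s = u := by
    by_contra hsu
    have hneg : G.excess (A \ p.toFinset) u < 0 := by
      rw [hex, if_neg hsu, if_pos rfl, if_neg huv.symm]
      split_ifs <;> omega
    obtain ⟨e, he, hte⟩ : ∃ e ∈ A \ p.toFinset, G.tgt e = u := by
      by_contra! hne
      refine hneg.not_ge ?_
      rw [excess, Finsupp.finsetSum_apply]
      refine Finset.sum_nonneg fun e he => ?_
      simp only [boundary, Finsupp.sub_apply, Finsupp.single_apply, if_neg (hne e he)]
      split_ifs <;> simp
    obtain ⟨heA, hep⟩ := Finset.mem_sdiff.1 he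
    have := hmax (e :: p) ⟨⟨List.nodup_cons.2 ⟨fun h => hep (List.mem_toFinset.2 h), hp⟩, ?_,
      G.src e, v, rfl, hte ▸ hw⟩, fun f hf => List.mem_cons_of_mem _ (hRp f hf)⟩
    · simp at this
    · intro f hf
      rcases List.mem_cons.1 hf with rfl | hf
      · exact heA
      · exact hpA f hf
  obtain ⟨P, hP, hPA⟩ := G.exists_edgeDisjointPaths hst k (A \ p.toFinset)
    (by rw [hex, if_pos rfl, if_neg hst.symm, if_neg huv.symm]; omega)
    (by
      intro x hx
      rw [hex, if_neg hx.symm]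
      split_ifs <;> omega)
  exact ⟨P, hP, hPA.trans (Finset.sdiff_subset_sdiff subset_rfl
    fun e he => List.mem_toFinset.2 (hRp e he))⟩

end DirectedGraph

/-! ### Lifting weights -/

section Lifting

variable {E : Type*} [DecidableEq E] {F : Set (Finset E)} {A : Finset E}

open Classical in
/-- The neighbours of `e` in the dependency graph of `A`, as agents. -/
noncomputable def dependencyNeighbors (F : Set (Finset E)) (A : Finset E) (e : E) : Finset E :=
  {f ∈ A | f ≠ e ∧ ∀ T ∈ F, T ⊆ A → f ∈ T ∨ e ∈ T}

theorem mem_dependencyNeighbors {e f : E} : f ∈ dependencyNeighbors F A e ↔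
    f ∈ A ∧ f ≠ e ∧ ∀ T ∈ F, T ⊆ A → f ∈ T ∨ e ∈ T := by
  classical
  simp [dependencyNeighbors]

theorem mem_dependencyNeighbors_comm {e f : E} (he : e ∈ A)
    (h : f ∈ dependencyNeighbors F A e) : e ∈ dependencyNeighbors F A f := by
  obtain ⟨-, hne, h⟩ := mem_dependencyNeighbors.1 h
  exact mem_dependencyNeighbors.2 ⟨he, hne.symm, fun T hT hTA => (h T hT hTA).symm⟩

theorem IsLiftingWeight.sum_neighbors {w : E → ℝ} (hw : IsLiftingWeight F A w) {e : E}
    (he : e ∈ A) :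
    ∑ f ∈ dependencyNeighbors F A e, w f = componentEigenvalue F A
      ((dependencyGraph F A).connectedComponentMk ⟨e, he⟩) * w e := by
  classical
  set C := (dependencyGraph F A).connectedComponentMk ⟨e, he⟩ with hC
  let e' : C := ⟨⟨e, he⟩, SimpleGraph.ConnectedComponent.connectedComponentMk_mem⟩
  have h := congrFun (hw.eigen C) e'
  rw [componentMatrix, SimpleGraph.adjMatrix_mulVec_apply] at h
  simp only [Pi.smul_apply, smul_eq_mul] at h
  rw [← h]
  symm
  refine Finset.sum_nbij (fun f => ((f : A) : E)) ?_ ?_ ?_ fun _ _ => rfl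
  · intro f hf
    have hadj : (dependencyGraph F A).Adj ⟨e, he⟩ f := by
      rw [SimpleGraph.mem_neighborFinset] at hf
      exact hf
    exact mem_dependencyNeighbors.2 ⟨f.1.2, fun h => hadj.1 (Subtype.ext h.symm),
      fun T hT hTA => (hadj.2 T hT hTA).symm⟩
  · intro f _ g _ hfg
    exact Subtype.ext (Subtype.ext hfg)
  · intro f hf
    obtain ⟨hfA, hne, hf⟩ := mem_dependencyNeighbors.1 (Finset.mem_coe.1 hf)
    have hadj : (dependencyGraph F A).Adj ⟨e, he⟩ ⟨f, hfA⟩ :=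
      ⟨fun h => hne (congrArg Subtype.val h).symm, fun T hT hTA => (hf T hT hTA).symm⟩
    refine ⟨⟨⟨f, hfA⟩, ?_⟩, ?_, rfl⟩
    · exact (SimpleGraph.ConnectedComponent.sound hadj.symm.reachable)
    · rw [Finset.mem_coe, SimpleGraph.mem_neighborFinset]
      exact hadj

theorem IsLiftingWeight.sum_neighbors_le {w : E → ℝ} (hw : IsLiftingWeight F A w) {e : E}
    (he : e ∈ A) :
    ∑ f ∈ dependencyNeighbors F A e, w f ≤ dependencyEigenvalue F A * w e := by
  rw [hw.sum_neighbors he]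
  exact mul_le_mul_of_nonneg_right (le_ciSup (Set.finite_range _).bddAbove _) (hw.pos e he).le

theorem IsLiftingWeight.dependencyEigenvalue_nonneg {w : E → ℝ} (hw : IsLiftingWeight F A w) :
    0 ≤ dependencyEigenvalue F A := by
  refine Real.iSup_nonneg fun C => ?_
  induction C using SimpleGraph.ConnectedComponent.ind with
  | h e =>
    refine nonneg_of_mul_nonneg_left ?_ (hw.pos e e.2)
    rw [← hw.sum_neighbors e.2]
    exact Finset.sum_nonneg fun f hf => (hw.pos f (mem_dependencyNeighbors.1 hf).1).le

end Lifting

/-! ### The upper bound on the payments -/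

namespace PruningLiftingKPaths

variable {V E : Type*} [DecidableEq E] {G : DirectedGraph V E} {s t : V} {k : ℕ}
  (M : PruningLiftingKPaths G s t k)

theorem excess_prune (c : E → ℝ≥0) :
    G.excess (M.prune c) = (k + 1) • (Finsupp.single s 1 - Finsupp.single t 1) := by
  obtain ⟨P, hP, hPA⟩ := (M.prune_cheapest c).1
  rw [← hPA, hP.excess_pathsUnion]

/-- An edge on a closed trail of the pruned graph is dispensable in the pruning stage: without the
trail there are still `k + 1` edge-disjoint paths, of no larger cost. -/
theorem exists_pathUnion_avoiding (hst : s ≠ t) (c : E → ℝ≥0) {e : E}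
    (he : e ∈ G.cyclicEdges (M.prune c)) :
    c e = 0 ∧ ∃ A ∈ G.pathUnions s t (k + 1), e ∉ A ∧ ∑ f ∈ A, c f ≤ ∑ f ∈ M.prune c, c f := by
  classical
  obtain ⟨-, u, p, hp, hpA, hep, hw⟩ := Finset.mem_filter.1 he
  have hsub : p.toFinset ⊆ M.prune c := fun f hf => hpA f (List.mem_toFinset.1 hf)
  obtain ⟨P, hP, hPA⟩ := G.exists_edgeDisjointPaths_of_excess_eq hst (n := k + 1)
    (A := M.prune c \ p.toFinset) (by
      rw [G.excess_sdiff hsub, hw.excess_toFinset hp, M.excess_prune]; simp)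
  have hle : ∑ f ∈ pathsUnion P, c f ≤ ∑ f ∈ M.prune c \ p.toFinset, c f :=
    Finset.sum_le_sum_of_subset hPA
  have hmin := (M.prune_cheapest c).2 _ ⟨P, hP, rfl⟩
  have hsplit : ∑ f ∈ M.prune c \ p.toFinset, c f + ∑ f ∈ p.toFinset, c f = ∑ f ∈ M.prune c, c f :=
    Finset.sum_sdiff hsub
  have hce : c e ≤ ∑ f ∈ p.toFinset, c f :=
    Finset.single_le_sum (f := c) (fun _ _ => zero_le) (List.mem_toFinset.2 hep)
  refine ⟨?_, pathsUnion P, ⟨P, hP, rfl⟩, fun h => ?_, ?_⟩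
  · rw [← hsplit] at hmin
    have h0 : ∑ f ∈ p.toFinset, c f ≤ 0 := by
      have := hmin.trans hle
      rwa [add_le_iff_nonpos_right] at this
    exact le_antisymm (hce.trans h0) zero_le
  · exact (Finset.mem_sdiff.1 (hPA h)).2 (List.mem_toFinset.2 hep)
  · exact hle.trans (hsplit ▸ le_self_add)

theorem pruneThreshold_eq_zero (hst : s ≠ t) (c : E → ℝ≥0) {e : E}
    (he : e ∈ G.cyclicEdges (M.prune c)) : M.pruneThreshold c e = 0 := by
  classical
  obtain ⟨hce, A, hA, heA, hle⟩ := M.exists_pathUnion_avoiding hst c he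
  refine le_antisymm (le_of_forall_gt fun y hy => ?_) zero_le
  obtain ⟨x, hx0, hxy⟩ := ENNReal.lt_iff_exists_nnreal_btwn.1 hy
  refine (iInf₂_le x fun hmem => ?_).trans_lt hxy
  have h1 := (M.prune_cheapest (Function.update c e x)).2 A hA
  rw [Finset.sum_update_of_notMem heA, Finset.sum_update_of_mem hmem] at h1
  have h2 := (M.prune_cheapest c).2 _ (M.prune_cheapest (Function.update c e x)).1
  rw [← Finset.add_sum_erase _ c hmem, hce, zero_add, ← Finset.sdiff_singleton_eq_erase] at h2
  have h3 : x ≤ 0 := by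
    have := h1.trans (hle.trans h2)
    rwa [add_le_iff_nonpos_left] at this
  exact (ENNReal.coe_pos.1 hx0).not_ge h3

/-- A winner `e` that lies on no closed trail can be replaced by its losing neighbours in the
dependency graph (and the free edges on closed trails), which bounds the bids at which it wins. -/
theorem selectThreshold_le [Finite E] (hst : s ≠ t) (c : E → ℝ≥0) {e : E} (he : e ∈ M.winners c)
    (hcyc : e ∉ G.cyclicEdges (M.prune c)) :
    M.selectThreshold c e ≤ ENNReal.ofReal (M.weight (M.prune c) e *
      ∑ f ∈ dependencyNeighbors (G.kPathsSystem s t k) (M.prune c) e \ M.winners c,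
        (c f : ℝ) / M.weight (M.prune c) f) := by
  classical
  set A := M.prune c with hA
  set S := M.winners c with hS
  set w := M.weight A with hw
  set F := G.kPathsSystem s t k with hF
  have hAmem : A ∈ G.pathUnions s t (k + 1) := (M.prune_cheapest c).1
  obtain ⟨hSF, hSA⟩ := M.select_feasible A hAmem c
  have hwpos : ∀ f ∈ A, 0 < w f := (M.weight_lifting A hAmem).pos
  set N := dependencyNeighbors F A e with hN
  -- The losers that are on no closed trail and not neighbours of `e` form, together with `e`, an
  -- independent set.
  set R := (insert e (A \ S) \ N) \ G.cyclicEdges A with hR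
  have hRA : R ⊆ A := fun f hf => by
    have := (Finset.mem_sdiff.1 (Finset.mem_sdiff.1 hf).1).1
    rcases Finset.mem_insert.1 this with rfl | h
    · exact hSA he
    · exact (Finset.mem_sdiff.1 h).1
  have hT : A \ R ∈ F := by
    refine G.sdiff_mem_kPathsSystem (M.excess_prune c) hst hRA
      (fun f hf => (Finset.mem_sdiff.1 hf).2) fun f hf g hg hfg => ?_
    obtain ⟨hf', hfN⟩ := Finset.mem_sdiff.1 (Finset.mem_sdiff.1 hf).1
    obtain ⟨hg', hgN⟩ := Finset.mem_sdiff.1 (Finset.mem_sdiff.1 hg).1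
    rcases Finset.mem_insert.1 hf' with rfl | hf''
    · by_contra! hne
      refine hgN (mem_dependencyNeighbors.2 ⟨hRA hg, hfg.symm, fun T hT hTA => ?_⟩)
      by_cases h : f ∈ T
      · exact Or.inr h
      · exact Or.inl (hne T hT hTA h)
    · rcases Finset.mem_insert.1 hg' with rfl | hg''
      · by_contra! hne
        refine hfN (mem_dependencyNeighbors.2 ⟨hRA hf, hfg, fun T hT hTA => ?_⟩)
        by_cases h : f ∈ T
        · exact Or.inl h
        · exact Or.inr (hne T hT hTA h)
      · exact ⟨S, hSF, hSA, (Finset.mem_sdiff.1 hf'').2, (Finset.mem_sdiff.1 hg'').2⟩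
  have heN : e ∉ N := fun h => (mem_dependencyNeighbors.1 h).2.1 rfl
  have heT : e ∉ A \ R := fun h => (Finset.mem_sdiff.1 h).2 (Finset.mem_sdiff.2
    ⟨Finset.mem_sdiff.2 ⟨Finset.mem_insert_self _ _, heN⟩, hcyc⟩)
  have hTsum : ∑ f ∈ A \ R, (c f : ℝ) / w f ≤
      ∑ f ∈ S.erase e, (c f : ℝ) / w f + ∑ f ∈ N \ S, (c f : ℝ) / w f := by
    rw [← Finset.sum_union (Finset.disjoint_left.2 fun f hf hf' =>
      (Finset.mem_sdiff.1 hf').2 (Finset.mem_of_mem_erase hf))]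
    have hnn : ∀ f ∈ A, 0 ≤ (c f : ℝ) / w f := fun f hf => div_nonneg (c f).2 (hwpos f hf).le
    have hUA : S.erase e ∪ N \ S ⊆ A := by
      intro f hf
      rcases Finset.mem_union.1 hf with h | h
      · exact hSA (Finset.mem_of_mem_erase h)
      · exact (mem_dependencyNeighbors.1 (Finset.mem_sdiff.1 h).1).1
    rw [← Finset.sum_filter_ne_zero]
    refine Finset.sum_le_sum_of_subset_of_nonneg (fun f hf => ?_) fun f hf _ => hnn f (hUA hf)
    obtain ⟨hf, hne⟩ := Finset.mem_filter.1 hf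
    have hfcyc : f ∉ G.cyclicEdges A := fun h => hne (by
      rw [(M.exists_pathUnion_avoiding hst c h).1]; simp)
    have hfe : f ≠ e := fun h => heT (h ▸ hf)
    obtain ⟨hfA, hfR⟩ := Finset.mem_sdiff.1 hf
    simp only [hR, Finset.mem_sdiff, Finset.mem_insert, Finset.mem_union, Finset.mem_erase]
      at hfR ⊢
    tauto
  refine iSup₂_le fun x hx => ?_
  rw [← ENNReal.ofReal_coe_nnreal]
  refine ENNReal.ofReal_le_ofReal ?_
  -- Compare the winners at the bid `x` with `A \ R` at the bid `x`, and with `S` at the true bids.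
  have hupd : ∀ f, f ≠ e → (Function.update c e x f : ℝ) / w f = (c f : ℝ) / w f := fun f hf => by
    rw [Function.update_of_ne hf]
  have h1 := M.select_cheapest A hAmem (Function.update c e x) _ hT Finset.sdiff_subset
  rw [Finset.sum_congr rfl fun f hf => hupd f (ne_of_mem_of_not_mem hf heT),
    ← Finset.add_sum_erase _ _ hx,
    Finset.sum_congr rfl fun f hf => hupd f (Finset.ne_of_mem_erase hf),
    Function.update_self] at h1
  obtain ⟨hxF, hxA⟩ := M.select_feasible A hAmem (Function.update c e x)
  have h2 := M.select_cheapest A hAmem c _ hxF hxA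
  rw [← Finset.add_sum_erase _ _ hx, ← Finset.add_sum_erase (M.select A c) _ he] at h2
  have h3 : (x : ℝ) / w e ≤ ∑ f ∈ N \ S, (c f : ℝ) / w f := by
    have h4 : M.select A c = S := rfl
    rw [h4] at h2
    linarith
  rwa [div_le_iff₀ (hwpos e (hSA he)), mul_comm] at h3

/-- The payments sum to at most `α` times the cost of the losers among the surviving edges. -/
theorem totalPayment_le [Fintype E] (hst : s ≠ t) (c : E → ℝ≥0) :
    M.totalPayment c ≤ ENNReal.ofReal (dependencyEigenvalue (G.kPathsSystem s t k) (M.prune c) *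
      ∑ e ∈ M.prune c \ M.winners c, (c e : ℝ)) := by
  classical
  set A := M.prune c with hA
  set S := M.winners c with hS
  set w := M.weight A with hw
  set F := G.kPathsSystem s t k with hF
  have hAmem : A ∈ G.pathUnions s t (k + 1) := (M.prune_cheapest c).1
  have hSA : S ⊆ A := (M.select_feasible A hAmem c).2
  have hlift := M.weight_lifting A hAmem
  have hwpos : ∀ f ∈ A, 0 < w f := hlift.pos
  let N := dependencyNeighbors F A
  have hNA : ∀ e, N e ⊆ A := fun e f hf => (mem_dependencyNeighbors.1 hf).1
  have hnn : ∀ f ∈ A, 0 ≤ (c f : ℝ) / w f := fun f hf => div_nonneg (c f).2 (hwpos f hf).le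
  calc M.totalPayment c = ∑ e ∈ S, min (M.pruneThreshold c e) (M.selectThreshold c e) := by
        simp only [totalPayment, payment, ← hS, Finset.sum_ite_mem, Finset.univ_inter]
    _ ≤ ∑ e ∈ S, ENNReal.ofReal (w e * ∑ f ∈ N e \ S, (c f : ℝ) / w f) := by
        refine Finset.sum_le_sum fun e he => ?_
        by_cases hcyc : e ∈ G.cyclicEdges A
        · rw [M.pruneThreshold_eq_zero hst c hcyc]
          simp
        · exact (min_le_right _ _).trans (M.selectThreshold_le hst c he hcyc)
    _ = ENNReal.ofReal (∑ e ∈ S, w e * ∑ f ∈ N e \ S, (c f : ℝ) / w f) := by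
        refine (ENNReal.ofReal_sum_of_nonneg fun e he => ?_).symm
        exact mul_nonneg (hwpos e (hSA he)).le (Finset.sum_nonneg fun f hf =>
          hnn f (hNA e (Finset.mem_sdiff.1 hf).1))
    _ ≤ _ := by
        refine ENNReal.ofReal_le_ofReal ?_
        calc ∑ e ∈ S, w e * ∑ f ∈ N e \ S, (c f : ℝ) / w f
            = ∑ e ∈ S, ∑ f ∈ N e \ S, w e * ((c f : ℝ) / w f) := by simp only [Finset.mul_sum]
          _ = ∑ f ∈ A \ S, ∑ e ∈ N f ∩ S, w e * ((c f : ℝ) / w f) := by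
              refine Finset.sum_comm' fun e f => ?_
              simp only [Finset.mem_sdiff, Finset.mem_inter]
              constructor
              · rintro ⟨he, hf, hfS⟩
                exact ⟨⟨mem_dependencyNeighbors_comm (hSA he) hf, he⟩, hNA e hf, hfS⟩
              · rintro ⟨⟨he, heS⟩, hfA, hfS⟩
                exact ⟨heS, mem_dependencyNeighbors_comm hfA he, hfS⟩
          _ ≤ ∑ f ∈ A \ S, dependencyEigenvalue F A * (c f : ℝ) := by
              refine Finset.sum_le_sum fun f hf => ?_
              have hfA := (Finset.mem_sdiff.1 hf).1
              rw [← Finset.sum_mul]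
              calc _ ≤ (dependencyEigenvalue F A * w f) * ((c f : ℝ) / w f) := by
                    refine mul_le_mul_of_nonneg_right ?_ (hnn f hfA)
                    refine le_trans ?_ (hlift.sum_neighbors_le hfA)
                    exact Finset.sum_le_sum_of_subset_of_nonneg Finset.inter_subset_left
                      fun e he _ => (hwpos e (hNA f he)).le
                _ = _ := by
                    have := (hwpos f hfA).ne'
                    field_simp
          _ = _ := by rw [Finset.mul_sum]

end PruningLiftingKPaths

/-! ### The frugality ratio -/

theorem mainTheorem2 {V E : Type*} [Fintype E] [DecidableEq E] (G : DirectedGraph V E)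
    (s t : V) (hst : s ≠ t) (k : ℕ) (hk : 1 ≤ k)
    (hG : MonopolyFree (G.kPathsSystem s t k))
    (M : PruningLiftingKPaths G s t k)
    (σ : (E → ℝ≥0) → Finset E) (hσ : ∀ c, IsCheapest (G.kPathsSystem s t k) c (σ c)) :
    muFrugalityRatio (G.kPathsSystem s t k) σ M.totalPayment ≤
      ENNReal.ofReal (G.alphaSucc s t k / k) := by
  refine iSup_le fun c => ENNReal.div_le_of_le_mul ?_
  have hA := M.prune_cheapest c
  obtain ⟨hSF, hSA⟩ := M.select_feasible _ hA.1 c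
  have hα : dependencyEigenvalue (G.kPathsSystem s t k) (M.prune c) ≤ G.alphaSucc s t k :=
    le_csSup ((Set.toFinite _).image _).bddAbove ⟨_, hA.1, rfl⟩
  have hα0 := (M.weight_lifting _ hA.1).dependencyEigenvalue_nonneg
  have hsplit : ∑ e ∈ M.prune c \ M.winners c, (c e : ℝ) + ∑ e ∈ M.winners c, (c e : ℝ) =
      ∑ e ∈ M.prune c, (c e : ℝ) := Finset.sum_sdiff hSA
  have hcheap : ∑ e ∈ σ c, (c e : ℝ) ≤ ∑ e ∈ M.winners c, (c e : ℝ) := by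
    exact_mod_cast (hσ c).2 _ hSF
  have hnn : 0 ≤ ∑ e ∈ M.prune c \ M.winners c, (c e : ℝ) :=
    Finset.sum_nonneg fun e _ => (c e).2
  set δ := ∑ e ∈ M.prune c, (c e : ℝ) - ∑ e ∈ σ c, (c e : ℝ) with hδ
  have hlose : ∑ e ∈ M.prune c \ M.winners c, (c e : ℝ) ≤ δ := by linarith
  have hk0 : (k : ℝ) ≠ 0 := by
    have : k ≠ 0 := by omega
    exact_mod_cast this
  calc M.totalPayment c ≤ _ := M.totalPayment_le hst c
    _ ≤ ENNReal.ofReal (G.alphaSucc s t k * δ) := by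
        refine ENNReal.ofReal_le_ofReal ?_
        exact mul_le_mul hα hlose hnn (hα0.trans hα)
    _ = ENNReal.ofReal (G.alphaSucc s t k / k) * ENNReal.ofReal (k * δ) := by
        rw [← ENNReal.ofReal_mul (div_nonneg (hα0.trans hα) k.cast_nonneg)]
        congr 1
        field_simp
    _ ≤ _ := by
        gcongr
        exact G.le_benchmarkMu_kPathsSystem hst hG (hσ c) hA
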